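/- **Definitions.** A set $S\subseteq\mathbb{R}^n$ is *semi-algebraic* if it is a finite union of sets of the form $\{x : p(x)=0,\ q_j(x)>0 \text{ for all } j\in J\}$ with $J$ finite and $p,q_j$ real polynomials. $\mathcal{SA}$ is the class of functions $h:\mathbb{R}^n\to\mathbb{R}\cup\{\pm\infty\}$ such that the sets $\{h\in\mathbb{R}\}$, $\{h=+\infty\}$, $\{h=-\infty\}$ are semi-algebraic and the graph of $h$ restricted to $\{h\in\mathbb{R}\}$ is a semi-algebraic subset of $\mathbb{R}^{n+1}$. $\mathcal{PP}$ is the class of *piecewise polynomial* functions $f:\mathbb{R}^n\to\mathbb{R}$, i.e. those for which there are a finite partition of $\mathbb{R}^n$ into semi-algebraic sets $S_1,\dots,S_N$ and polynomials $p_1,\dots,p_N$ with $f(x)=\sum_{i=1}^N \mathbf 1_{S_i}(x)\,p_i(x)$ for all $x\in\mathbb{R}^n$. An *unbounded box* is a nonempty set $\mathcal{Y}=\{y\in\mathbb{R}^m : a_i\le y_i\le b_i,\ i=1,\dots,m\}$ with $a_i,b_i\in\mathbb{R}\cup\{\pm\infty\}$ and $a_i=-\infty$ or $b_i=+\infty$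 for at least one $i$. Given polynomials $P,Q:\mathbb{R}^n\times\mathbb{R}^m\to\mathbb{R}$ and such a box, put $\Theta(x)=\operatorname{arg\,min}_{y\in\mathcal{Y}}Q(x,y)$ and $$\varphi_{\mathrm{optim}}(x)=\inf_{y\in\Theta(x)}P(x,y),\qquad \varphi_{\mathrm{pessim}}(x)=\sup_{y\in\Theta(x)}P(x,y),$$ with values in $\mathbb{R}\cup\{\pm\infty\}$, $\inf\emptyset=+\infty$ and $\sup\emptyset=-\infty$. For $\mathrm{mode}\in\{\mathrm{optim},\mathrm{pessim}\}$ let $\mathcal{C}^{\mathrm{mode}}_{\mathrm{unbound}}$ be the class of functions on $\mathbb{R}^n$ that are equal to $\varphi_{\mathrm{mode}}$ for some $m$, some polynomials $P,Q$ and some unbounded box $\mathcal{Y}\subseteq\mathbb{R}^m$ such that $Q(x,\cdot)$ is convex on $\mathbb{R}^m$ for every $x\in\mathbb{R}^n$. Let $\widetilde{\mathcal{C}}^{\mathrm{mode}}_{\mathrm{unbound}}$ be the class defined in the same way, with $Q(x,\cdot)$ only required to be convex on $\mathcal{Y}$ for every $x$. **Theorem.** (Piecewise polynomials are value functions with convex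 lower level.) For every $n$, any piecewise polynomial function on $\mathbb{R}^n$ is the value function of an optimistic (resp. pessimistic) polynomial bilevel problem with convex lower-level objective over an unbounded box. More specifically, $$\mathcal{PP}\subseteq\mathcal{C}^{\mathrm{optim}}_{\mathrm{unbound}}\subseteq\widetilde{\mathcal{C}}^{\mathrm{optim}}_{\mathrm{unbound}}\subseteq\mathcal{SA},\qquad \mathcal{PP}\subseteq\mathcal{C}^{\mathrm{pessim}}_{\mathrm{unbound}}\subseteq\widetilde{\mathcal{C}}^{\mathrm{pessim}}_{\mathrm{unbound}}\subseteq\mathcal{SA}.$$ In particular $\mathcal{PP}\subseteq\mathcal{C}\subseteq\mathcal{SA}$ holds under either reading of convexity of the lower-level objective. -/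

import Mathlib

namespace Bilevel

/-- Basic semi-algebraic sets `{x | P x = 0 and Q x > 0 for all Q ∈ J}`, with `J` finite. -/
def IsBasicSemialgebraic {n : ℕ} (S : Set (Fin n → ℝ)) : Prop :=
  ∃ (P : MvPolynomial (Fin n) ℝ) (J : Finset (MvPolynomial (Fin n) ℝ)),
    S = {x | MvPolynomial.eval x P = 0 ∧ ∀ Q ∈ J, 0 < MvPolynomial.eval x Q}

/-- Semi-algebraic sets: finite unions of basic semi-algebraic sets. -/
def IsSemialgebraic {n : ℕ} (S : Set (Fin n → ℝ)) : Prop :=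
  ∃ C : Set (Set (Fin n → ℝ)), C.Finite ∧ (∀ T ∈ C, IsBasicSemialgebraic T) ∧ S = ⋃₀ C

/-- The restriction of `f` to `U` is a semi-algebraic function: its graph
`{(x, f x) | x ∈ U}` is a semi-algebraic subset of `ℝⁿ⁺¹`. -/
def IsSemialgebraicFunOn {n : ℕ} (U : Set (Fin n → ℝ)) (f : (Fin n → ℝ) → ℝ) : Prop :=
  IsSemialgebraic {z : Fin (n + 1) → ℝ | ∃ x ∈ U, z = Fin.snoc x (f x)}

/-- The class `SA` of extended-real-valued semi-algebraic functions on `ℝⁿ`. -/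
def SA (n : ℕ) : Set ((Fin n → ℝ) → EReal) :=
  {h | IsSemialgebraic {x | h x ≠ ⊤ ∧ h x ≠ ⊥} ∧
    IsSemialgebraic {x | h x = ⊤} ∧
    IsSemialgebraic {x | h x = ⊥} ∧
    IsSemialgebraicFunOn {x | h x ≠ ⊤ ∧ h x ≠ ⊥} (fun x => (h x).toReal)}

/-- Piecewise polynomial functions: polynomial on each piece of a finite semi-algebraic
partition of `ℝⁿ`. -/
def IsPiecewisePolynomial {n : ℕ} (f : (Fin n → ℝ) → ℝ) : Prop :=
  ∃ (N : ℕ) (S : Fin N → Set (Fin n → ℝ)) (p : Fin N → MvPolynomial (Fin n) ℝ),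
    (∀ i, IsSemialgebraic (S i)) ∧
    Pairwise (fun i j => Disjoint (S i) (S j)) ∧
    (⋃ i, S i) = Set.univ ∧
    ∀ x, f x = ∑ i, (S i).indicator (fun _ => (1 : ℝ)) x * MvPolynomial.eval x (p i)

/-- The class `PP` of piecewise polynomial functions, seen as extended-real-valued functions. -/
def PP (n : ℕ) : Set ((Fin n → ℝ) → EReal) :=
  {h | ∃ f : (Fin n → ℝ) → ℝ, IsPiecewisePolynomial f ∧ ∀ x, h x = (f x : EReal)}

/-- The value at `(x, y) ∈ ℝⁿ × ℝᵐ` of a polynomial in `n + m` variables. -/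
noncomputable def evalPair {n m : ℕ} (P : MvPolynomial (Fin n ⊕ Fin m) ℝ)
    (x : Fin n → ℝ) (y : Fin m → ℝ) : ℝ :=
  MvPolynomial.eval (Sum.elim x y) P

/-- The box `[a₁, b₁] × ⋯ × [aₘ, bₘ]` in `ℝᵐ`, with possibly infinite end points. -/
def box {m : ℕ} (a b : Fin m → EReal) : Set (Fin m → ℝ) :=
  {y | ∀ i, a i ≤ (y i : EReal) ∧ (y i : EReal) ≤ b i}

/-- `a` and `b` are the end points of an unbounded (nonempty) box. -/
def IsUnboundedBox {m : ℕ} (a b : Fin m → EReal) : Prop :=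
  (box a b).Nonempty ∧ ∃ i, a i = ⊥ ∨ b i = ⊤

/-- `Θ(x)`, the set of minimizers of `Q(x, ·)` over `Y`. -/
def lowerArgmin {n m : ℕ} (Q : MvPolynomial (Fin n ⊕ Fin m) ℝ) (Y : Set (Fin m → ℝ))
    (x : Fin n → ℝ) : Set (Fin m → ℝ) :=
  {y | y ∈ Y ∧ ∀ y' ∈ Y, evalPair Q x y ≤ evalPair Q x y'}

/-- The two conventions for choosing among lower-level minimizers. -/
inductive Mode
  | optim
  | pessim

/-- The value function of the bilevel problem with upper level `P`, lower level `Q` and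
lower-level feasible set `Y`: infimum (optimistic) or supremum (pessimistic) of `P(x, ·)` over
`Θ(x)` in the extended reals, so `⊤` (resp. `⊥`) if `Θ(x)` is empty. -/
noncomputable def valueFunction {n m : ℕ} (mode : Mode) (P Q : MvPolynomial (Fin n ⊕ Fin m) ℝ)
    (Y : Set (Fin m → ℝ)) (x : Fin n → ℝ) : EReal :=
  match mode with
  | Mode.optim => ⨅ y ∈ lowerArgmin Q Y x, (evalPair P x y : EReal)
  | Mode.pessim => ⨆ y ∈ lowerArgmin Q Y x, (evalPair P x y : EReal)

/-- Value functions of polynomial bilevel problems over an unbounded box whose lower-level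
objective `Q(x, ·)` is convex on the whole space `ℝᵐ`, for every `x`. -/
def ConvexUnbound (mode : Mode) (n : ℕ) : Set ((Fin n → ℝ) → EReal) :=
  {h | ∃ (m : ℕ) (P Q : MvPolynomial (Fin n ⊕ Fin m) ℝ) (a b : Fin m → EReal),
    IsUnboundedBox a b ∧ (∀ x, ConvexOn ℝ Set.univ (evalPair Q x)) ∧
    h = valueFunction mode P Q (box a b)}

/-- The same, with `Q(x, ·)` only required to be convex over the box. -/
def ConvexOverBoxUnbound (mode : Mode) (n : ℕ) : Set ((Fin n → ℝ) → EReal) :=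
  {h | ∃ (m : ℕ) (P Q : MvPolynomial (Fin n ⊕ Fin m) ℝ) (a b : Fin m → EReal),
    IsUnboundedBox a b ∧ (∀ x, ConvexOn ℝ (box a b) (evalPair Q x)) ∧
    h = valueFunction mode P Q (box a b)}

end Bilevel

/-! A piecewise polynomial is a polynomial in the coordinates and in finitely many indicators of
sets `{c > 0}` with `c` a polynomial. Such indicators come from convex least squares: a minimizer `y
≥ 0` of `(c(x) y - 1)²` satisfies `c(x) y = 1` if `c(x) > 0` and `c(x) y = 0` otherwise. Summing
these squares over the indicators and substituting `c(x) y` for each indicator in the polynomial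
gives an upper level that is constant on the argmin, so both modes return the given function
(`PP_subset_convexUnbound`).

That value functions are semi-algebraic is quantifier elimination: `φ_optim(x) < s` and `s <
φ_pessim(x)` are existential statements over the semi-algebraic set of minimizers. Tarski–Seidenberg
(`setOf_exists_option_mem`) is obtained from an algebra `A` of functions, maximal by Zorn among
those containing the polynomials and having semi-algebraic positivity sets. Maximality closes `A`
under pointwise inverses and under branches of roots, so every polynomial over `A` has its roots
among finitely many members of `A` (`hasRoots_of_maximal`). A real quantifier then reduces to
finitely many test points in `A`. -/

namespace Bilevel

open Polynomial

/-! ### Boolean algebras of sets and maximal adapted function algebras -/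

section SetAlgebra

variable {X : Type*} {B : BooleanSubalgebra (Set X)}

lemma setOf_and_mem {P Q : X → Prop} (hP : {x | P x} ∈ B) (hQ : {x | Q x} ∈ B) :
    {x | P x ∧ Q x} ∈ B := BooleanSubalgebra.inf_mem hP hQ

lemma setOf_or_mem {P Q : X → Prop} (hP : {x | P x} ∈ B) (hQ : {x | Q x} ∈ B) :
    {x | P x ∨ Q x} ∈ B := BooleanSubalgebra.sup_mem hP hQ

lemma setOf_not_mem {P : X → Prop} (hP : {x | P x} ∈ B) : {x | ¬ P x} ∈ B :=
  BooleanSubalgebra.compl_mem hP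

lemma setOf_imp_mem {P Q : X → Prop} (hP : {x | P x} ∈ B) (hQ : {x | Q x} ∈ B) :
    {x | P x → Q x} ∈ B := by
  simpa only [imp_iff_not_or] using setOf_or_mem (setOf_not_mem hP) hQ

lemma setOf_exists_finset_mem {ι : Type*} (R : Finset ι) {P : ι → X → Prop}
    (h : ∀ r ∈ R, {x | P r x} ∈ B) : {x | ∃ r ∈ R, P r x} ∈ B := by
  classical
  induction R using Finset.induction_on with
  | empty => simpa using B.bot_mem
  | insert a R _ ih =>
    simp only [Finset.mem_insert, exists_eq_or_imp]
    exact setOf_or_mem (h a (by simp)) (ih fun r hr => h r (by simp [hr]))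

lemma setOf_forall_finset_mem {ι : Type*} (R : Finset ι) {P : ι → X → Prop}
    (h : ∀ r ∈ R, {x | P r x} ∈ B) : {x | ∀ r ∈ R, P r x} ∈ B := by
  have := setOf_not_mem (setOf_exists_finset_mem R fun r hr => setOf_not_mem (h r hr))
  simpa using this

end SetAlgebra

/-- A function algebra all of whose members have their positivity set in `B`. -/
def IsAdapted {X : Type*} (B : BooleanSubalgebra (Set X)) (A : Subalgebra ℝ (X → ℝ)) : Prop :=
  ∀ a ∈ A, {x | 0 < a x} ∈ B

section Specialize

variable {X : Type*} {A : Subalgebra ℝ (X → ℝ)}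

/-- Evaluation at a point, as a ring homomorphism on a function algebra. -/
def evalAt (A : Subalgebra ℝ (X → ℝ)) (x : X) : A →+* ℝ :=
  (Pi.evalRingHom (fun _ => ℝ) x).comp A.subtype

@[simp] lemma evalAt_apply (x : X) (a : A) : evalAt A x a = (a : X → ℝ) x := rfl

/-- The real polynomial obtained by evaluating the coefficients of `p` at `x`. -/
noncomputable def spec (p : A[X]) (x : X) : ℝ[X] := p.map (evalAt A x)

lemma eval_spec_mem (p : A[X]) {a : X → ℝ} (ha : a ∈ A) :
    (fun x => (spec p x).eval (a x)) ∈ A := by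
  have : (fun x => (spec p x).eval (a x)) = ((p.eval ⟨a, ha⟩ : A) : X → ℝ) := by
    funext x
    have := Polynomial.eval_map_apply (p := p) (f := evalAt A x) ⟨a, ha⟩
    simpa [spec] using this
  rw [this]
  exact Subtype.property _

end Specialize

section Adapted

variable {X : Type*} {B : BooleanSubalgebra (Set X)} {A : Subalgebra ℝ (X → ℝ)}

lemma IsAdapted.lt_mem (hA : IsAdapted B A) {a b : X → ℝ} (ha : a ∈ A) (hb : b ∈ A) :
    {x | a x < b x} ∈ B := by
  simpa using hA _ (sub_mem hb ha)

lemma IsAdapted.le_mem (hA : IsAdapted B A) {a b : X → ℝ} (ha : a ∈ A) (hb : b ∈ A) :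
    {x | a x ≤ b x} ∈ B := by
  simpa using setOf_not_mem (hA.lt_mem hb ha)

lemma IsAdapted.eq_mem (hA : IsAdapted B A) {a b : X → ℝ} (ha : a ∈ A) (hb : b ∈ A) :
    {x | a x = b x} ∈ B := by
  simpa only [le_antisymm_iff] using setOf_and_mem (hA.le_mem ha hb) (hA.le_mem hb ha)

lemma const_mem (c : ℝ) : (fun _ => c) ∈ A := A.algebraMap_mem c

/-- Adaptedness is tested on one function at a time, so it passes to the union of a chain. -/
lemma exists_maximal_isAdapted {A₀ : Subalgebra ℝ (X → ℝ)} (h₀ : IsAdapted B A₀) :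
    ∃ A, A₀ ≤ A ∧ Maximal (IsAdapted B) A := by
  refine zorn_le_nonempty₀ {A | IsAdapted B A} (fun c hc hchain y hy => ?_) A₀ h₀
  refine ⟨sSup c, ?_, fun z hz => le_sSup hz⟩
  intro a ha
  have : Nonempty c := ⟨⟨y, hy⟩⟩
  have hdir : Directed (· ≤ ·) (fun i : c => (i : Subalgebra ℝ (X → ℝ))) :=
    hchain.directedOn.directed_val
  rw [sSup_eq_iSup', ← SetLike.mem_coe, Subalgebra.coe_iSup_of_directed hdir] at ha
  obtain ⟨i, hi⟩ := Set.mem_iUnion.1 ha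
  exact hc i.2 a hi

lemma aeval_apply_eq (p : A[X]) (g : X → ℝ) (x : X) :
    (aeval g p) x = (spec p x).eval (g x) := by
  rw [spec, Polynomial.eval_map, Polynomial.aeval_def]
  exact Polynomial.hom_eval₂ p (algebraMap A (X → ℝ)) (Pi.evalRingHom (fun _ => ℝ) x) g

lemma isAdapted_adjoin {g : X → ℝ} (hg : ∀ p : A[X], {x | 0 < (spec p x).eval (g x)} ∈ B) :
    IsAdapted B ((Algebra.adjoin A {g}).restrictScalars ℝ) := by
  intro a ha
  rw [Subalgebra.mem_restrictScalars, Algebra.adjoin_singleton_eq_range_aeval] at ha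
  obtain ⟨p, hp⟩ := ha
  have ha' : ∀ x, a x = (spec p x).eval (g x) := fun x => by
    rw [← aeval_apply_eq, ← hp]; rfl
  simpa only [ha'] using hg p

lemma le_adjoin (g : X → ℝ) : A ≤ (Algebra.adjoin A {g}).restrictScalars ℝ := by
  intro a ha
  rw [Subalgebra.mem_restrictScalars]
  exact (Algebra.adjoin A {g}).algebraMap_mem ⟨a, ha⟩

lemma self_mem_adjoin (g : X → ℝ) : g ∈ (Algebra.adjoin A {g}).restrictScalars ℝ := by
  rw [Subalgebra.mem_restrictScalars]
  exact Algebra.subset_adjoin (Set.mem_singleton g)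

/-- The way maximality is used: adjoining `g` to `A` yields only polynomials in `g` over `A`, so it
suffices to control their signs. -/
lemma mem_of_maximal (hA : Maximal (IsAdapted B) A) {g : X → ℝ}
    (hg : ∀ p : A[X], {x | 0 < (spec p x).eval (g x)} ∈ B) : g ∈ A := by
  have h := hA.le_of_ge (isAdapted_adjoin hg) (le_adjoin g)
  exact h (self_mem_adjoin g)

/-- Where `a` vanishes, `a⁻¹` is `0` by convention. Elsewhere `p(1/a)` is the reversed polynomial at
`a` divided by a power of `a`, and a quotient has the sign of the corresponding product, which lies
in `A`. -/
lemma inv_mem_of_maximal (hA : Maximal (IsAdapted B) A) {a : X → ℝ} (ha : a ∈ A) : a⁻¹ ∈ A := by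
  refine mem_of_maximal hA fun p => ?_
  have h0 : (fun _ => (0 : ℝ)) ∈ A := const_mem 0
  have hset : {x | 0 < (spec p x).eval (a⁻¹ x)} =
      {x | (a x = 0 ∧ 0 < (spec p x).eval 0) ∨
        (¬ a x = 0 ∧ 0 < (spec p.reverse x).eval (a x) * (a x) ^ p.natDegree)} := by
    ext x
    by_cases hx : a x = 0
    · simp [hx]
    · have : Invertible (a x)⁻¹ := invertibleOfNonzero (inv_ne_zero hx)
      have h := Polynomial.eval₂_reverse_mul_pow (evalAt A x) (a x)⁻¹ p
      rw [invOf_eq_inv, inv_inv, ← Polynomial.eval_map, ← Polynomial.eval_map] at h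
      simp only [Pi.inv_apply, Set.mem_ofPred_eq, hx, false_and, not_false_eq_true, true_and,
        false_or]
      rw [spec, ← h, spec, inv_pow, ← div_eq_mul_inv]
      generalize (Polynomial.map (evalAt A x) p.reverse).eval (a x) = u
      have hne : (a x) ^ p.natDegree ≠ 0 := pow_ne_zero _ hx
      rw [div_pos_iff, mul_pos_iff]
  rw [hset]
  exact setOf_or_mem
    (setOf_and_mem (hA.1.eq_mem ha h0) (hA.1.lt_mem h0 (eval_spec_mem p h0)))
    (setOf_and_mem (setOf_not_mem (hA.1.eq_mem ha h0))
      (hA.1.lt_mem h0 (mul_mem (eval_spec_mem _ ha) (pow_mem ha _))))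

end Adapted

end Bilevel

namespace Bilevel

open Polynomial

/-! ### Real polynomials in one variable: sign changes, Rolle, a root bound -/

section RealPolynomial

lemma exists_root_of_mul_neg {f : ℝ[X]} {a b : ℝ} (hab : a < b)
    (h : f.eval a * f.eval b < 0) : ∃ t, a < t ∧ t < b ∧ f.eval t = 0 := by
  have hc : ContinuousOn (fun t => f.eval t) (Set.Icc a b) := f.continuous.continuousOn
  rcases mul_neg_iff.1 h with ⟨h1, h2⟩ | ⟨h1, h2⟩
  · obtain ⟨t, ht, h0⟩ := intermediate_value_Ioo' hab.le hc ⟨h2, h1⟩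
    exact ⟨t, ht.1, ht.2, h0⟩
  · obtain ⟨t, ht, h0⟩ := intermediate_value_Ioo hab.le hc ⟨h1, h2⟩
    exact ⟨t, ht.1, ht.2, h0⟩

lemma eval_pos_of_no_root {f : ℝ[X]} {t t' : ℝ}
    (h : ∀ z ∈ Set.uIcc t t', f.eval z ≠ 0) (ht : 0 < f.eval t) : 0 < f.eval t' := by
  by_contra! hneg
  have hmem : (0 : ℝ) ∈ Set.uIcc (f.eval t) (f.eval t') := Set.mem_uIcc.2 (Or.inr ⟨hneg, ht.le⟩)
  obtain ⟨z, hz, h0⟩ :=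
    intermediate_value_uIcc (f := fun t => f.eval t) f.continuous.continuousOn hmem
  exact h z hz h0

lemma eq_of_eval_eq_of_derivative_ne_zero {f : ℝ[X]} {r s t t' : ℝ}
    (h : ∀ z, r < z → z < s → f.derivative.eval z ≠ 0) (ht : r ≤ t) (ht' : t' ≤ s)
    (heq : f.eval t = f.eval t') : ¬ t < t' := by
  intro hlt
  obtain ⟨c, hc, h0⟩ := exists_hasDerivAt_eq_zero (f := fun t => f.eval t)
    (f' := fun t => f.derivative.eval t) hlt f.continuous.continuousOn heq
    fun z _ => f.hasDerivAt z
  exact h c (ht.trans_lt hc.1) (hc.2.trans_le ht') h0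

/-- Cauchy's bound, weakened by `|c| ≤ 1 + c²` to an expression polynomial in the coefficients, so
that over `A` it defines a member of `A`. -/
lemma abs_lt_of_isRoot_monic {f : ℝ[X]} (hf : f.Monic) {t : ℝ} (ht : f.eval t = 0) :
    |t| < 1 + ∑ i ∈ Finset.range f.natDegree, (1 + f.coeff i ^ 2) := by
  have h := IsRoot.norm_lt_cauchyBound hf.ne_zero (a := t) ht
  have h2 : cauchyBound f ≤ ∑ i ∈ Finset.range f.natDegree, ‖f.coeff i‖₊ + 1 := by
    rw [cauchyBound, hf.leadingCoeff, nnnorm_one, div_one]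
    gcongr
    refine Finset.sup_le fun i hi => ?_
    exact Finset.single_le_sum (f := fun i => ‖f.coeff i‖₊) (fun _ _ => zero_le) hi
  have h3 : |t| < ((∑ i ∈ Finset.range f.natDegree, ‖f.coeff i‖₊ + 1 : NNReal) : ℝ) := by
    have := NNReal.coe_lt_coe.2 (h.trans_le h2)
    simpa using this
  refine h3.trans_le ?_
  push_cast
  rw [add_comm]
  gcongr with i hi
  rw [Real.norm_eq_abs, ← sq_abs]
  nlinarith [sq_nonneg (|f.coeff i| - 1)]

end RealPolynomial

/-- There are finitely many members of `A` whose values at `x` contain all roots of the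
specialization of `p` at `x`, whenever this specialization is nonzero. -/
def HasRoots {X : Type*} {A : Subalgebra ℝ (X → ℝ)} (p : A[X]) : Prop :=
  ∃ R : Finset (X → ℝ), (∀ r ∈ R, r ∈ A) ∧
    ∀ x t, spec p x ≠ 0 → (spec p x).eval t = 0 → ∃ r ∈ R, r x = t

/-! ### Roots of polynomials over a maximal adapted algebra -/

section Roots

variable {X : Type*} {B : BooleanSubalgebra (Set X)} {A : Subalgebra ℝ (X → ℝ)}

/-- On `(r, s)` the polynomial changes sign only at `g`, so a point there lies left of `g` exactly
when `p` has the same sign at it as at `r`. This compares `a` with `g` without evaluating `g`. -/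
lemma branch_lt_mem (hA : IsAdapted B A) {p : A[X]} {r s g a : X → ℝ} {D : Set X}
    (hr : r ∈ A) (hs : s ∈ A) (ha : a ∈ A) (hD : D ∈ B)
    (hg : ∀ x ∈ D, r x < g x ∧ g x < s x ∧ (spec p x).eval (r x) * (spec p x).eval (s x) < 0 ∧
      ∀ t, r x < t → t < s x → ((spec p x).eval t = 0 ↔ t = g x)) :
    {x | x ∈ D ∧ a x < g x} ∈ B := by
  have h0 : (fun _ => (0 : ℝ)) ∈ A := const_mem 0
  have hset : {x | x ∈ D ∧ a x < g x} = {x | x ∈ D ∧ (a x ≤ r x ∨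
      (a x < s x ∧ 0 < (spec p x).eval (a x) * (spec p x).eval (r x)))} := by
    ext x
    refine and_congr_right fun hx => ?_
    obtain ⟨h1, h2, h3, h4⟩ := hg x hx
    constructor
    · intro h
      rcases le_or_gt (a x) (r x) with h5 | h5
      · exact Or.inl h5
      refine Or.inr ⟨h.trans h2, ?_⟩
      by_contra! h6
      rcases h6.lt_or_eq with h7 | h7
      · obtain ⟨t, t1, t2, t3⟩ := exists_root_of_mul_neg h5 (by rwa [mul_comm] at h7)
        have := (h4 t t1 (t2.trans (h.trans h2))).1 t3
        linarith
      · rcases mul_eq_zero.1 h7 with h8 | h8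
        · exact h.ne ((h4 _ h5 (h.trans h2)).1 h8)
        · rw [h8, zero_mul] at h3
          exact lt_irrefl _ h3
    · rintro (h | ⟨h5, h6⟩)
      · exact h.trans_lt h1
      · rcases le_or_gt (a x) (r x) with h7 | h7
        · exact h7.trans_lt h1
        have h8 : (spec p x).eval (a x) * (spec p x).eval (s x) < 0 := by
          rcases mul_neg_iff.1 h3 with ⟨u, v⟩ | ⟨u, v⟩ <;>
          rcases mul_pos_iff.1 h6 with ⟨w, z⟩ | ⟨w, z⟩ <;> first | linarith | nlinarith
        obtain ⟨t, t1, t2, t3⟩ := exists_root_of_mul_neg h5 h8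
        rw [← (h4 t (h7.trans t1) t2).1 t3]
        exact t1
  rw [hset]
  exact setOf_and_mem hD (setOf_or_mem (hA.le_mem ha hr) (setOf_and_mem (hA.lt_mem ha hs)
    (hA.lt_mem h0 (mul_mem (eval_spec_mem p ha) (eval_spec_mem p hr)))))

/-- At a root of `p`, any `q` agrees with its remainder modulo `p`, whose degree is smaller and
whose roots are therefore known members of `A`. Locating `g` among them determines the sign of
`q(g)`. -/
lemma branch_mem [Nonempty X] (hA : Maximal (IsAdapted B) A) {p : A[X]} (hp : p.Monic)
    (hroots : ∀ q : A[X], q.degree < p.degree → HasRoots q)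
    {r s g : X → ℝ} {D : Set X} (hr : r ∈ A) (hs : s ∈ A) (hD : D ∈ B)
    (hg : ∀ x ∈ D, r x < g x ∧ g x < s x ∧ (spec p x).eval (r x) * (spec p x).eval (s x) < 0 ∧
      ∀ t, r x < t → t < s x → ((spec p x).eval t = 0 ↔ t = g x))
    (hg0 : ∀ x ∉ D, g x = 0) : g ∈ A := by
  classical
  refine mem_of_maximal hA fun q => ?_
  have h0 : (fun _ => (0 : ℝ)) ∈ A := const_mem 0
  set q' := q %ₘ p with hq'
  have hmod : ∀ x ∈ D, (spec q x).eval (g x) = (spec q' x).eval (g x) := by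
    intro x hx
    obtain ⟨h1, h2, _, h4⟩ := hg x hx
    have hroot := (h4 _ h1 h2).2 rfl
    have := congrArg (fun f : A[X] => (f.map (evalAt A x)).eval (g x))
      (Polynomial.modByMonic_add_div q p)
    simp only [Polynomial.map_add, Polynomial.map_mul, eval_add, eval_mul] at this
    rw [spec] at hroot
    rw [hroot, zero_mul, add_zero] at this
    exact this.symm
  obtain ⟨Z, hZA, hZ⟩ := hroots q' (Polynomial.degree_modByMonic_lt q hp)
  have hlt : ∀ a ∈ A, {x | x ∈ D ∧ a x < g x} ∈ B := fun a ha =>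
    branch_lt_mem hA.1 hr hs ha hD hg
  have heq : ∀ a ∈ A, {x | x ∈ D ∧ g x = a x} ∈ B := by
    intro a ha
    have : {x | x ∈ D ∧ g x = a x} = {x | x ∈ D ∧ r x < a x ∧ a x < s x ∧
        (spec p x).eval (a x) = 0} := by
      ext x
      refine and_congr_right fun hx => ?_
      obtain ⟨h1, h2, _, h4⟩ := hg x hx
      constructor
      · intro h
        rw [← h]
        exact ⟨h1, h2, (h4 _ h1 h2).2 rfl⟩
      · rintro ⟨h5, h6, h7⟩
        exact ((h4 _ h5 h6).1 h7).symm
    rw [this]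
    exact setOf_and_mem hD (setOf_and_mem (hA.1.lt_mem hr ha) (setOf_and_mem (hA.1.lt_mem ha hs)
      (hA.1.eq_mem (eval_spec_mem p ha) h0)))
  have hgt : ∀ a ∈ A, {x | x ∈ D ∧ g x < a x} ∈ B := by
    intro a ha
    have : {x | x ∈ D ∧ g x < a x} =
        {x | x ∈ D ∧ ¬ (x ∈ D ∧ a x < g x) ∧ ¬ (x ∈ D ∧ g x = a x)} := by
      ext x
      refine and_congr_right fun hx => ?_
      simp only [hx, true_and, not_lt, ← ne_eq]
      exact lt_iff_le_and_ne
    rw [this]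
    exact setOf_and_mem hD (setOf_and_mem (setOf_not_mem (hlt a ha)) (setOf_not_mem (heq a ha)))
  have hWA : ∀ u ∈ insert r (insert s Z), u ∈ A := by
    simp only [Finset.mem_insert, forall_eq_or_imp]
    exact ⟨hr, hs, hZA⟩
  have hmid : ∀ u ∈ A, ∀ v ∈ A, (fun x => (u x + v x) / 2) ∈ A := fun u hu v hv => by
    have := mul_mem (add_mem hu hv) (const_mem (A := A) (1 / 2))
    convert this using 1
    funext x
    simp [div_eq_mul_inv]
  -- Either `g` meets a candidate `z`, or it lies strictly between neighbours `u` and `v` with no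
  -- candidate root in between, and the midpoint shows the sign. Candidates need not be roots, so
  -- positivity is still tested at `z`. Including `r` and `s` ensures that the neighbours exist.
  have hset : {x | 0 < (spec q x).eval (g x)} = {x | (¬ x ∈ D ∧ 0 < (spec q x).eval 0) ∨
      (∃ z ∈ Z, (x ∈ D ∧ g x = z x) ∧ 0 < (spec q' x).eval (z x)) ∨
      ∃ u ∈ insert r (insert s Z), ∃ v ∈ insert r (insert s Z), (x ∈ D ∧ u x < g x) ∧
        (x ∈ D ∧ g x < v x) ∧ (∀ z ∈ Z, z x ≤ u x ∨ v x ≤ z x) ∧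
        0 < (spec q' x).eval ((u x + v x) / 2)} := by
    ext x
    change 0 < (spec q x).eval (g x) ↔ (_ ∨ _)
    by_cases hx : x ∈ D
    swap
    · simp [hx, hg0 x hx]
    simp only [hx, true_and, not_true_eq_false, false_and, false_or, hmod x hx]
    obtain ⟨h1, h2, _, _⟩ := hg x hx
    constructor
    · intro hpos
      by_cases hz : ∃ z ∈ Z, g x = z x
      · obtain ⟨z, hz, hgz⟩ := hz
        exact Or.inl ⟨z, hz, hgz, hgz ▸ hpos⟩
      right
      push Not at hz
      obtain ⟨u, hu, hu'⟩ := Finset.exists_max_image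
        ((insert r (insert s Z)).filter fun w => w x < g x) (fun w => w x) ⟨r, by simp [h1]⟩
      obtain ⟨v, hv, hv'⟩ := Finset.exists_min_image
        ((insert r (insert s Z)).filter fun w => g x < w x) (fun w => w x) ⟨s, by simp [h2]⟩
      rw [Finset.mem_filter] at hu hv
      have hsep : ∀ z ∈ Z, z x ≤ u x ∨ v x ≤ z x := by
        intro z hzZ
        rcases lt_or_gt_of_ne (hz z hzZ) with h | h
        · exact Or.inr (hv' z (by simp [hzZ, h]))
        · exact Or.inl (hu' z (by simp [hzZ, h]))
      refine ⟨u, hu.1, v, hv.1, hu.2, hv.2, hsep, eval_pos_of_no_root (t := g x) ?_ hpos⟩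
      intro w hw hw0
      have hne : spec q' x ≠ 0 := fun h => by simp [h] at hpos
      obtain ⟨z, hzZ, rfl⟩ := hZ x w hne hw0
      have := hsep z hzZ
      rcases Set.mem_uIcc.1 hw with hw | hw <;> rcases this with h | h <;> linarith [hu.2, hv.2]
    · rintro (⟨z, _, hgz, hpos⟩ | ⟨u, hu, v, hv, hug, hgv, hsep, hpos⟩)
      · rwa [hgz]
      · refine eval_pos_of_no_root (t := (u x + v x) / 2) ?_ hpos
        intro w hw hw0
        have hne : spec q' x ≠ 0 := fun h => by simp [h] at hpos
        obtain ⟨z, hzZ, rfl⟩ := hZ x w hne hw0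
        have := hsep z hzZ
        rcases Set.mem_uIcc.1 hw with hw | hw <;> rcases this with h | h <;> linarith
  rw [hset]
  refine setOf_or_mem (setOf_and_mem (setOf_not_mem hD) (hA.1.lt_mem h0 (eval_spec_mem q h0)))
    (setOf_or_mem ?_ ?_)
  · exact setOf_exists_finset_mem _ fun z hz => setOf_and_mem (heq z (hZA z hz))
      (hA.1.lt_mem h0 (eval_spec_mem q' (hZA z hz)))
  · refine setOf_exists_finset_mem _ fun u hu => setOf_exists_finset_mem _ fun v hv =>
      setOf_and_mem (hlt u (hWA u hu)) (setOf_and_mem (hgt v (hWA v hv)) (setOf_and_mem ?_ ?_))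
    · exact setOf_forall_finset_mem _ fun z hz => setOf_or_mem
        (hA.1.le_mem (hZA z hz) (hWA u hu)) (hA.1.le_mem (hWA v hv) (hZA z hz))
    · exact hA.1.lt_mem h0 (eval_spec_mem q' (hmid u (hWA u hu) v (hWA v hv)))

/-- The branch of roots of a monic polynomial between two consecutive separators. -/
lemma exists_branch [Nonempty X] (hA : Maximal (IsAdapted B) A) {p : A[X]} (hp : p.Monic)
    (hroots : ∀ q : A[X], q.degree < p.degree → HasRoots q)
    {R : Finset (X → ℝ)} (hR : ∀ r ∈ R, r ∈ A)
    (hcrit : ∀ x t, (spec p x).derivative.eval t = 0 → ∃ r ∈ R, r x = t)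
    {r s : X → ℝ} (hr : r ∈ A) (hs : s ∈ A) :
    ∃ g ∈ A, ∀ x t, (∀ z ∈ R, z x ≤ r x ∨ s x ≤ z x) → r x < t → t < s x →
      (spec p x).eval t = 0 → g x = t := by
  classical
  let D : Set X := {x | r x < s x ∧ (∀ z ∈ R, z x ≤ r x ∨ s x ≤ z x) ∧
    (spec p x).eval (r x) * (spec p x).eval (s x) < 0}
  have h0 : (fun _ => (0 : ℝ)) ∈ A := const_mem 0
  have hD : D ∈ B := by
    refine setOf_and_mem (hA.1.lt_mem hr hs) (setOf_and_mem ?_ ?_)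
    · exact setOf_forall_finset_mem _ fun z hz =>
        setOf_or_mem (hA.1.le_mem (hR z hz) hr) (hA.1.le_mem hs (hR z hz))
    · exact hA.1.lt_mem (mul_mem (eval_spec_mem p hr) (eval_spec_mem p hs)) h0
  have hder : ∀ x, (∀ z ∈ R, z x ≤ r x ∨ s x ≤ z x) →
      ∀ z, r x < z → z < s x → (spec p x).derivative.eval z ≠ 0 := by
    intro x hx z h1 h2 h3
    obtain ⟨c, hc, rfl⟩ := hcrit x z h3
    rcases hx c hc with h | h <;> linarith
  have huniq : ∀ x, (∀ z ∈ R, z x ≤ r x ∨ s x ≤ z x) → ∀ t t', r x ≤ t → t ≤ s x → r x ≤ t' →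
      t' ≤ s x → (spec p x).eval t = (spec p x).eval t' → t = t' := by
    intro x hx t t' h1 h2 h3 h4 h5
    exact le_antisymm (not_lt.1 (eq_of_eval_eq_of_derivative_ne_zero (hder x hx) h3 h2 h5.symm))
      (not_lt.1 (eq_of_eval_eq_of_derivative_ne_zero (hder x hx) h1 h4 h5))
  let g : X → ℝ := fun x => if hx : x ∈ D then
    (exists_root_of_mul_neg hx.1 hx.2.2).choose else 0
  have hgspec : ∀ x ∈ D, r x < g x ∧ g x < s x ∧ (spec p x).eval (g x) = 0 := by
    intro x hx
    have := (exists_root_of_mul_neg hx.1 hx.2.2).choose_spec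
    simpa only [g, dif_pos hx] using this
  have hgA : g ∈ A := by
    refine branch_mem hA hp hroots hr hs hD (fun x hx => ?_) fun x hx => dif_neg hx
    obtain ⟨h1, h2, h3⟩ := hgspec x hx
    refine ⟨h1, h2, hx.2.2, fun t ht1 ht2 => ⟨fun h => ?_, fun h => h ▸ h3⟩⟩
    exact huniq x hx.2.1 _ _ ht1.le ht2.le h1.le h2.le (h.trans h3.symm)
  refine ⟨g, hgA, fun x t hx h1 h2 h3 => ?_⟩
  have hrs := h1.trans h2
  -- By Rolle the polynomial is injective, hence strictly monotone, on `[r x, s x]`; an interior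
  -- root then forces opposite signs at the end points.
  have hxD : x ∈ D := by
    refine ⟨hrs, hx, ?_⟩
    have hinj : Set.InjOn (fun t => (spec p x).eval t) (Set.Icc (r x) (s x)) :=
      fun u hu v hv huv => huniq x hx u v hu.1 hu.2 hv.1 hv.2 huv
    have hmem : t ∈ Set.Icc (r x) (s x) := ⟨h1.le, h2.le⟩
    have hl := Set.left_mem_Icc.2 hrs.le
    have hu := Set.right_mem_Icc.2 hrs.le
    rcases (spec p x).continuous.continuousOn.strictMonoOn_of_injOn_Icc' hrs.le hinj with hm | hm
    · have k1 := hm hl hmem h1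
      have k2 := hm hmem hu h2
      simp only [h3] at k1 k2
      exact mul_neg_of_neg_of_pos k1 k2
    · have k1 := hm hl hmem h1
      have k2 := hm hmem hu h2
      simp only [h3] at k1 k2
      exact mul_neg_of_pos_of_neg k1 k2
  obtain ⟨k1, k2, k3⟩ := hgspec x hxD
  exact huniq x hx _ _ k1.le k2.le h1.le h2.le (k3.trans h3.symm)

/-- The critical points, known from the derivative, together with the root bounds `±M` cut the line
into intervals on which `p` is monotone. A root is either a critical point or the single root
between two neighbouring separators. -/
lemma hasRoots_monic [Nonempty X] (hA : Maximal (IsAdapted B) A) {p : A[X]} (hp : p.Monic)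
    (hroots : ∀ q : A[X], q.degree < p.degree → HasRoots q) : HasRoots p := by
  classical
  have hmonic : ∀ x, (spec p x).Monic := fun x => hp.map _
  have hnat : ∀ x, (spec p x).natDegree = p.natDegree := fun x => hp.natDegree_map _
  obtain ⟨R, hRA, hR⟩ := hroots p.derivative (degree_derivative_lt hp.ne_zero)
  let M : X → ℝ := fun x => 1 + ∑ i ∈ Finset.range p.natDegree, (1 + (spec p x).coeff i ^ 2)
  have hM : M ∈ A := by
    have : M = ((1 + ∑ i ∈ Finset.range p.natDegree, (1 + p.coeff i ^ 2) : A) : X → ℝ) := by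
      funext x
      simp [M, spec]
    rw [this]
    exact Subtype.property _
  have hM' : -M ∈ A := neg_mem hM
  have hcrit : ∀ x, (spec p x).natDegree ≠ 0 → ∀ t, (spec p x).derivative.eval t = 0 →
      ∃ r ∈ R, r x = t := by
    intro x hx t ht
    have hspec : spec p.derivative x = (spec p x).derivative := by
      rw [spec, spec, derivative_map]
    refine hR x t ?_ (hspec ▸ ht)
    rw [hspec]
    intro h
    exact hx (derivative_eq_zero.1 h)
  rcases Nat.eq_zero_or_pos p.natDegree with hd | hd
  · refine ⟨∅, by simp, fun x t _ h => ?_⟩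
    have := (hmonic x).natDegree_eq_zero.1 ((hnat x).trans hd)
    simp [this] at h
  have hcrit' : ∀ x t, (spec p x).derivative.eval t = 0 → ∃ r ∈ R, r x = t :=
    fun x => hcrit x (by rw [hnat]; exact hd.ne')
  let W := insert M (insert (-M) R)
  have hWA : ∀ u ∈ W, u ∈ A := by
    simp only [W, Finset.mem_insert, forall_eq_or_imp]
    exact ⟨hM, hM', hRA⟩
  have hbr : ∀ uv : (X → ℝ) × (X → ℝ), ∃ g ∈ A, uv.1 ∈ W → uv.2 ∈ W → ∀ x t,
      (∀ z ∈ R, z x ≤ uv.1 x ∨ uv.2 x ≤ z x) → uv.1 x < t → t < uv.2 x →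
      (spec p x).eval t = 0 → g x = t := by
    intro uv
    by_cases h : uv.1 ∈ W ∧ uv.2 ∈ W
    · obtain ⟨g, hg, h'⟩ := exists_branch hA hp hroots hRA hcrit' (hWA _ h.1) (hWA _ h.2)
      exact ⟨g, hg, fun _ _ => h'⟩
    · exact ⟨fun _ => 0, const_mem 0, fun h1 h2 => absurd ⟨h1, h2⟩ h⟩
  choose g hgA hg using hbr
  refine ⟨R ∪ (W ×ˢ W).image g, ?_, fun x t _ ht => ?_⟩
  · intro r hr
    rcases Finset.mem_union.1 hr with hr | hr
    · exact hRA r hr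
    · obtain ⟨uv, _, rfl⟩ := Finset.mem_image.1 hr
      exact hgA uv
  by_cases hz : ∃ z ∈ R, z x = t
  · obtain ⟨z, hz, hzt⟩ := hz
    exact ⟨z, Finset.mem_union_left _ hz, hzt⟩
  push Not at hz
  have hbd := abs_lt.1 (abs_lt_of_isRoot_monic (hmonic x) ht)
  rw [hnat] at hbd
  obtain ⟨u, hu, hu'⟩ := Finset.exists_max_image (W.filter fun w => w x < t) (fun w => w x)
    ⟨-M, Finset.mem_filter.2 ⟨by simp [W], hbd.1⟩⟩
  obtain ⟨v, hv, hv'⟩ := Finset.exists_min_image (W.filter fun w => t < w x) (fun w => w x)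
    ⟨M, Finset.mem_filter.2 ⟨by simp [W], hbd.2⟩⟩
  rw [Finset.mem_filter] at hu hv
  refine ⟨g (u, v), Finset.mem_union_right _
    (Finset.mem_image_of_mem g (Finset.mk_mem_product hu.1 hv.1)), ?_⟩
  refine hg (u, v) hu.1 hv.1 x t (fun z hzR => ?_) hu.2 hv.2 ht
  rcases lt_or_gt_of_ne (hz z hzR) with h | h
  · exact Or.inl (hu' z (by simp [W, hzR, h]))
  · exact Or.inr (hv' z (by simp [W, hzR, h]))

/-- Induction on a degree bound. The coefficient `c` of degree `d` may vanish at some points: there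
`p` specializes to the lower part `e`. Elsewhere `p` is `c` times a monic polynomial whose
coefficients use `c⁻¹ ∈ A`. -/
theorem hasRoots_of_maximal [Nonempty X] (hA : Maximal (IsAdapted B) A) (p : A[X]) :
    HasRoots p := by
  classical
  suffices h : ∀ d : ℕ, ∀ p : A[X], p.degree < d → HasRoots p from
    h (p.natDegree + 1) p (degree_le_natDegree.trans_lt (by exact_mod_cast Nat.lt_succ_self _))
  intro d
  induction d with
  | zero =>
    intro p hp
    have : p = 0 := by
      rw [← degree_eq_bot]
      simpa using hp
    exact ⟨∅, by simp, fun x t h => by simp [this, spec] at h⟩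
  | succ d ih =>
    intro p hp
    let e := p.erase d
    have he : e.degree < d := by
      rw [degree_lt_iff_coeff_zero] at hp ⊢
      intro m hm
      rcases hm.eq_or_lt with rfl | hm
      · simp [e]
      · rw [coeff_erase, if_neg hm.ne', hp m hm]
    have hpe : monomial d (p.coeff d) + e = p := monomial_add_erase p d
    obtain ⟨R, hRA, hR⟩ := ih e he
    let c : X → ℝ := p.coeff d
    have hci : c⁻¹ ∈ A := inv_mem_of_maximal hA (p.coeff d).2
    let b : A := ⟨c⁻¹, hci⟩
    let q : A[X] := Polynomial.X ^ d + C b * e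
    have hlow : (C b * e).degree < (d : WithBot ℕ) := by
      rw [← smul_eq_C_mul]
      exact (degree_smul_le _ _).trans_lt he
    have hq : q.Monic := monic_X_pow_add hlow
    have hqd : q.degree = d := by
      rw [degree_add_eq_left_of_degree_lt] <;> simp [hlow]
    obtain ⟨R', hRA', hR'⟩ := hasRoots_monic hA hq fun r hr => ih r (hqd ▸ hr)
    refine ⟨R ∪ R', ?_, fun x t hx ht => ?_⟩
    · intro r hr
      exact (Finset.mem_union.1 hr).elim (hRA r) (hRA' r)
    have hp' : spec p x = C (c x) * Polynomial.X ^ d + spec e x := by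
      conv_lhs => rw [← hpe]
      simp [spec, c, C_mul_X_pow_eq_monomial]
    by_cases hc : c x = 0
    · rw [hc, C_0, zero_mul, zero_add] at hp'
      rw [hp'] at hx ht
      obtain ⟨r, hr, h⟩ := hR x t hx ht
      exact ⟨r, Finset.mem_union_left _ hr, h⟩
    · have hq' : spec p x = C (c x) * spec q x := by
        rw [hp']
        simp only [q, b, spec, Polynomial.map_add, Polynomial.map_mul, Polynomial.map_pow, map_X,
          map_C, evalAt_apply, Pi.inv_apply, mul_add, ← mul_assoc, ← C_mul, mul_inv_cancel₀ hc,
          C_1, one_mul]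
      rw [hq', eval_mul, eval_C] at ht
      obtain ⟨r, hr, h⟩ := hR' x t (hq.map _).ne_zero ((mul_eq_zero.1 ht).resolve_left hc)
      exact ⟨r, Finset.mem_union_right _ hr, h⟩

end Roots

end Bilevel

namespace Bilevel

/-- The Boolean algebra of semi-algebraic sets over an arbitrary set of variables. -/
def semialg (σ : Type*) : BooleanSubalgebra (Set (σ → ℝ)) :=
  BooleanSubalgebra.closure {S | ∃ p : MvPolynomial σ ℝ, S = {x | 0 < MvPolynomial.eval x p}}

/-! ### Tarski–Seidenberg quantifier elimination -/

section Semialg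

variable {σ τ : Type*}

lemma setOf_eval_pos_mem (p : MvPolynomial σ ℝ) : {x | 0 < MvPolynomial.eval x p} ∈ semialg σ :=
  BooleanSubalgebra.subset_closure ⟨p, rfl⟩

@[elab_as_elim]
lemma semialg_induction {P : ∀ S : Set (σ → ℝ), S ∈ semialg σ → Prop}
    (pos : ∀ p : MvPolynomial σ ℝ, P {x | 0 < MvPolynomial.eval x p} (setOf_eval_pos_mem p))
    (bot : P ∅ BooleanSubalgebra.bot_mem)
    (sup : ∀ S hS T hT, P S hS → P T hT → P (S ∪ T) (BooleanSubalgebra.sup_mem hS hT))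
    (compl : ∀ S hS, P S hS → P Sᶜ (BooleanSubalgebra.compl_mem hS))
    {S : Set (σ → ℝ)} (hS : S ∈ semialg σ) : P S hS := by
  refine BooleanSubalgebra.closure_bot_sup_induction (p := P) ?_ bot sup compl hS
  rintro _ ⟨p, rfl⟩
  exact pos p

lemma setOf_eval_lt_mem (p q : MvPolynomial σ ℝ) :
    {x | MvPolynomial.eval x p < MvPolynomial.eval x q} ∈ semialg σ := by
  simpa using setOf_eval_pos_mem (q - p)

lemma setOf_eval_le_mem (p q : MvPolynomial σ ℝ) :
    {x | MvPolynomial.eval x p ≤ MvPolynomial.eval x q} ∈ semialg σ := by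
  simpa using setOf_not_mem (setOf_eval_lt_mem q p)

lemma setOf_eval_eq_mem (p q : MvPolynomial σ ℝ) :
    {x | MvPolynomial.eval x p = MvPolynomial.eval x q} ∈ semialg σ := by
  simpa only [le_antisymm_iff] using setOf_and_mem (setOf_eval_le_mem p q) (setOf_eval_le_mem q p)

lemma preimage_mem_semialg (F : τ → MvPolynomial σ ℝ) {S : Set (τ → ℝ)} (hS : S ∈ semialg τ) :
    {x : σ → ℝ | (fun j => MvPolynomial.eval x (F j)) ∈ S} ∈ semialg σ := by
  induction hS using semialg_induction with
  | pos p =>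
    convert setOf_eval_pos_mem (MvPolynomial.bind₁ F p) using 4 with x
    rw [MvPolynomial.eval, MvPolynomial.eval₂Hom_bind₁]
    rfl
  | bot => exact (semialg σ).bot_mem
  | sup S _ T _ h1 h2 => exact setOf_or_mem h1 h2
  | compl S _ h => exact setOf_not_mem h

lemma reindex_mem_semialg (f : τ → σ) {S : Set (τ → ℝ)} (hS : S ∈ semialg τ) :
    {x : σ → ℝ | x ∘ f ∈ S} ∈ semialg σ := by
  have := preimage_mem_semialg (fun j => MvPolynomial.X (f j)) hS
  simp only [MvPolynomial.eval_X] at this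
  exact this

/-- Two reals have the same position relative to the values at `x` of the members of `R`. -/
def SamePosition {X : Type*} (R : Finset (X → ℝ)) (x : X) (t t' : ℝ) : Prop :=
  ∀ r ∈ R, (r x < t ↔ r x < t') ∧ (t < r x ↔ t' < r x)

lemma SamePosition.symm {X : Type*} {R : Finset (X → ℝ)} {x : X} {t t' : ℝ}
    (h : SamePosition R x t t') : SamePosition R x t' t :=
  fun r hr => ⟨(h r hr).1.symm, (h r hr).2.symm⟩

lemma SamePosition.mono {X : Type*} {R R' : Finset (X → ℝ)} {x : X} {t t' : ℝ}
    (h : SamePosition R x t t') (hR : R' ⊆ R) : SamePosition R' x t t' :=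
  fun r hr => h r (hR hr)

/-- With all roots among the values of `R`, no root separates `t` from `t'`. -/
lemma SamePosition.eval_pos {X : Type*} {R : Finset (X → ℝ)} {x : X} {t t' : ℝ}
    (h : SamePosition R x t t') {f : Polynomial ℝ}
    (hf : f ≠ 0 → ∀ z, f.eval z = 0 → ∃ r ∈ R, r x = z) (ht : 0 < f.eval t) : 0 < f.eval t' := by
  have hne : f ≠ 0 := fun h => by simp [h] at ht
  refine eval_pos_of_no_root (fun z hz hz0 => ?_) ht
  obtain ⟨r, hr, rfl⟩ := hf hne z hz0
  obtain ⟨h1, h2⟩ := h r hr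
  have htr : t ≠ r x := fun h => by rw [h, hz0] at ht; exact lt_irrefl _ ht
  rcases lt_or_gt_of_ne htr with h3 | h3
  · have := h2.1 h3
    rcases Set.mem_uIcc.1 hz with hz | hz <;> linarith
  · have := h1.1 h3
    rcases Set.mem_uIcc.1 hz with hz | hz <;> linarith

/-- Every position relative to the members of `R` is attained by one of finitely many functions
obtained from `R`. -/
lemma exists_samePosition {X : Type*} {A : Subalgebra ℝ (X → ℝ)} {R : Finset (X → ℝ)}
    (hR : ∀ r ∈ R, r ∈ A) :
    ∃ T : Finset (X → ℝ), (∀ a ∈ T, a ∈ A) ∧ ∀ x t, ∃ a ∈ T, SamePosition R x t (a x) := by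
  classical
  -- Test points: the values themselves, midpoints for gaps, `± 1` to pass beyond the extremes, and
  -- `0` for empty `R`.
  let T : Finset (X → ℝ) := insert 0 (R ∪ (R.image fun r => r + 1) ∪ (R.image fun r => r - 1) ∪
    (R ×ˢ R).image fun r => (1 / 2 : ℝ) • (r.1 + r.2))
  refine ⟨T, ?_, fun x t => ?_⟩
  · intro a ha
    simp only [T, Finset.mem_insert, Finset.mem_union, Finset.mem_image, Finset.mem_product,
      Prod.exists] at ha
    rcases ha with rfl | ((ha | ⟨r, hr, rfl⟩) | ⟨r, hr, rfl⟩) | ⟨r, s, ⟨hr, hs⟩, rfl⟩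
    · exact zero_mem A
    · exact hR a ha
    · exact add_mem (hR r hr) (one_mem A)
    · exact sub_mem (hR r hr) (one_mem A)
    · exact A.smul_mem (add_mem (hR r hr) (hR s hs)) _
  by_cases hz : ∃ z ∈ R, z x = t
  · obtain ⟨z, hz, rfl⟩ := hz
    exact ⟨z, by simp [T, hz], fun r _ => ⟨Iff.rfl, Iff.rfl⟩⟩
  push Not at hz
  rcases (R.filter fun w => w x < t).eq_empty_or_nonempty with hL | hL <;>
  rcases (R.filter fun w => t < w x).eq_empty_or_nonempty with hU | hU
  · refine ⟨0, by simp [T], fun r hr => ?_⟩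
    rw [Finset.filter_eq_empty_iff] at hL hU
    exact absurd (le_antisymm (not_lt.1 (hU hr)) (not_lt.1 (hL hr))) (hz r hr)
  · obtain ⟨v, hv, hv'⟩ := Finset.exists_min_image _ (fun w => w x) hU
    rw [Finset.mem_filter] at hv
    refine ⟨v - 1, by simp [T, hv.1], fun r hr => ?_⟩
    have h1 := not_lt.1 ((Finset.filter_eq_empty_iff.1 hL) hr)
    have h2 : t < r x := lt_of_le_of_ne h1 (hz r hr).symm
    have h3 := hv' r (by simp [hr, h2])
    simp only [Pi.sub_apply, Pi.one_apply]
    constructor <;> constructor <;> intro <;> linarith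
  · obtain ⟨u, hu, hu'⟩ := Finset.exists_max_image _ (fun w => w x) hL
    rw [Finset.mem_filter] at hu
    refine ⟨u + 1, by simp [T, hu.1], fun r hr => ?_⟩
    have h1 := not_lt.1 ((Finset.filter_eq_empty_iff.1 hU) hr)
    have h2 : r x < t := lt_of_le_of_ne h1 (hz r hr)
    have h3 := hu' r (by simp [hr, h2])
    simp only [Pi.add_apply, Pi.one_apply]
    constructor <;> constructor <;> intro <;> linarith
  · obtain ⟨v, hv, hv'⟩ := Finset.exists_min_image _ (fun w => w x) hU
    obtain ⟨u, hu, hu'⟩ := Finset.exists_max_image _ (fun w => w x) hL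
    rw [Finset.mem_filter] at hu hv
    refine ⟨(1 / 2 : ℝ) • (u + v), ?_, fun r hr => ?_⟩
    · simp only [T, Finset.mem_insert, Finset.mem_union, Finset.mem_image, Finset.mem_product,
        Prod.exists]
      exact Or.inr (Or.inr ⟨u, v, ⟨hu.1, hv.1⟩, rfl⟩)
    simp only [Pi.smul_apply, Pi.add_apply, smul_eq_mul]
    rcases lt_or_gt_of_ne (hz r hr) with h | h
    · have h3 := hu' r (by simp [hr, h])
      constructor <;> constructor <;> intro <;> linarith
    · have h3 := hv' r (by simp [hr, h])
      constructor <;> constructor <;> intro <;> linarith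

lemma exists_polynomial_spec {A : Subalgebra ℝ ((σ → ℝ) → ℝ)} (hA : ∀ i, (fun x => x i) ∈ A)
    (P : MvPolynomial (Option σ) ℝ) : ∃ p : Polynomial A, ∀ (x : σ → ℝ) (t : ℝ),
      (spec p x).eval t = MvPolynomial.eval (fun i : Option σ => i.elim t x) P := by
  induction P using MvPolynomial.induction_on with
  | C c => exact ⟨Polynomial.C (algebraMap ℝ A c), fun x t => by simp [spec]⟩
  | add P Q hP hQ =>
    obtain ⟨p, hp⟩ := hP
    obtain ⟨q, hq⟩ := hQ
    exact ⟨p + q, fun x t => by simp [← hp, ← hq, spec]⟩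
  | mul_X P i hP =>
    obtain ⟨p, hp⟩ := hP
    cases i with
    | none => exact ⟨p * Polynomial.X, fun x t => by simp [← hp, spec]⟩
    | some j => exact ⟨p * Polynomial.C ⟨_, hA j⟩, fun x t => by simp [← hp, spec]⟩

lemma isAdapted_range_aeval : IsAdapted (semialg σ)
    (MvPolynomial.aeval (R := ℝ) (fun (i : σ) (x : σ → ℝ) => x i)).range := by
  rintro _ ⟨p, rfl⟩
  convert setOf_eval_pos_mem p using 4 with x
  have h : (Pi.evalAlgHom ℝ (fun _ : σ → ℝ => ℝ) x).comp
      (MvPolynomial.aeval (R := ℝ) (fun (i : σ) (x : σ → ℝ) => x i)) = MvPolynomial.aeval x := by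
    ext i
    simp
  have := DFunLike.congr_fun h p
  simpa [MvPolynomial.coe_aeval_eq_eval] using this

/-- **Tarski–Seidenberg theorem**: eliminating one real quantifier. -/
theorem setOf_exists_option_mem {S : Set (Option σ → ℝ)} (hS : S ∈ semialg (Option σ)) :
    {x : σ → ℝ | ∃ t : ℝ, (fun i : Option σ => i.elim t x) ∈ S} ∈ semialg σ := by
  classical
  obtain ⟨A, hle, hA⟩ := exists_maximal_isAdapted (isAdapted_range_aeval (σ := σ))
  have hcoord : ∀ i, (fun x : σ → ℝ => x i) ∈ A := fun i => hle ⟨MvPolynomial.X i, by simp⟩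
  -- Existence of `t` does not pass to complements. Membership at each test point and invariance
  -- under `SamePosition` both do, so these are what the induction carries.
  have key : (∀ a ∈ A, {x : σ → ℝ | (fun i : Option σ => i.elim (a x) x) ∈ S} ∈ semialg σ) ∧
      ∃ R : Finset ((σ → ℝ) → ℝ), (∀ r ∈ R, r ∈ A) ∧ ∀ x t t', SamePosition R x t t' →
        ((fun i : Option σ => i.elim t x) ∈ S ↔ (fun i : Option σ => i.elim t' x) ∈ S) := by
    induction hS using semialg_induction with
    | pos P =>
      obtain ⟨p, hp⟩ := exists_polynomial_spec hcoord P
      refine ⟨fun a ha => ?_, ?_⟩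
      · have := hA.1 _ (eval_spec_mem p ha)
        simp only [hp] at this
        exact this
      · obtain ⟨R, hRA, hR⟩ := hasRoots_of_maximal hA p
        refine ⟨R, hRA, fun x t t' h => ?_⟩
        change 0 < MvPolynomial.eval _ P ↔ 0 < MvPolynomial.eval _ P
        rw [← hp, ← hp]
        exact ⟨h.eval_pos fun hne z hz => hR x z hne hz,
          h.symm.eval_pos fun hne z hz => hR x z hne hz⟩
    | bot => exact ⟨fun _ _ => (semialg σ).bot_mem, ∅, by simp, fun _ _ _ _ => Iff.rfl⟩
    | sup S _ T _ hS hT =>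
      obtain ⟨hS, R, hRA, hR⟩ := hS
      obtain ⟨hT, R', hRA', hR'⟩ := hT
      refine ⟨fun a ha => setOf_or_mem (hS a ha) (hT a ha), R ∪ R', fun r hr =>
        (Finset.mem_union.1 hr).elim (hRA r) (hRA' r), fun x t t' h => or_congr ?_ ?_⟩
      · exact hR x t t' (h.mono Finset.subset_union_left)
      · exact hR' x t t' (h.mono Finset.subset_union_right)
    | compl S _ hS =>
      obtain ⟨hS, R, hRA, hR⟩ := hS
      exact ⟨fun a ha => setOf_not_mem (hS a ha), R, hRA, fun x t t' h => not_congr (hR x t t' h)⟩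
  obtain ⟨hsub, R, hRA, hR⟩ := key
  obtain ⟨T, hTA, hT⟩ := exists_samePosition hRA
  have : {x : σ → ℝ | ∃ t : ℝ, (fun i : Option σ => i.elim t x) ∈ S} =
      {x | ∃ a ∈ T, (fun i : Option σ => i.elim (a x) x) ∈ S} := by
    ext x
    constructor
    · rintro ⟨t, ht⟩
      obtain ⟨a, ha, h⟩ := hT x t
      exact ⟨a, ha, (hR x _ _ h).1 ht⟩
    · rintro ⟨a, _, h⟩
      exact ⟨a x, h⟩
  rw [this]
  exact setOf_exists_finset_mem T fun a ha => hsub a (hTA a ha)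

/-- **Tarski–Seidenberg theorem**: eliminating finitely many real quantifiers. -/
theorem setOf_exists_sum_mem [Finite τ] {S : Set (σ ⊕ τ → ℝ)} (hS : S ∈ semialg (σ ⊕ τ)) :
    {x : σ → ℝ | ∃ y : τ → ℝ, Sum.elim x y ∈ S} ∈ semialg σ := by
  induction τ using Finite.induction_empty_option with
  | of_equiv e ih =>
    have := ih (reindex_mem_semialg (Sum.map id e.symm) hS)
    convert this using 3 with x
    refine ((e.arrowCongr (Equiv.refl ℝ)).exists_congr fun y => ?_).symm
    change Sum.elim x y ∘ Sum.map id e.symm ∈ S ↔ Sum.elim x (y ∘ e.symm) ∈ S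
    rw [Sum.elim_comp_map, Function.comp_id]
  | h_empty =>
    have := reindex_mem_semialg (Sum.elim id PEmpty.elim) hS
    convert this using 3 with x
    constructor
    · rintro ⟨y, hy⟩
      convert hy using 1
      funext i
      rcases i with i | i
      · simp
      · exact i.elim
    · intro hy
      refine ⟨PEmpty.elim, ?_⟩
      convert hy using 1
      funext i
      rcases i with i | i
      · simp
      · exact i.elim
  | h_option ih =>
    have := ih (setOf_exists_option_mem (reindex_mem_semialg
      (Sum.elim (fun i => some (Sum.inl i)) (fun j => j.elim none fun k => some (Sum.inr k))) hS))
    convert this using 3 with x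
    constructor
    · rintro ⟨y, hy⟩
      refine ⟨fun j => y (some j), y none, ?_⟩
      change _ ∈ S
      convert hy using 1
      funext i
      rcases i with i | (_ | i) <;> simp
    · rintro ⟨y, t, hy⟩
      refine ⟨fun j => j.elim t y, ?_⟩
      change _ ∈ S at hy
      convert hy using 1
      funext i
      rcases i with i | (_ | i) <;> simp

theorem setOf_forall_sum_mem [Finite τ] {S : Set (σ ⊕ τ → ℝ)} (hS : S ∈ semialg (σ ⊕ τ)) :
    {x : σ → ℝ | ∀ y : τ → ℝ, Sum.elim x y ∈ S} ∈ semialg σ := by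
  have := setOf_not_mem (setOf_exists_sum_mem (S := Sᶜ) (BooleanSubalgebra.compl_mem hS))
  simpa using this

end Semialg

end Bilevel

namespace Bilevel

/-! ### Semi-algebraic sets as a Boolean algebra -/

section Sets

variable {n : ℕ}

lemma IsBasicSemialgebraic.isSemialgebraic {S : Set (Fin n → ℝ)} (h : IsBasicSemialgebraic S) :
    IsSemialgebraic S :=
  ⟨{S}, Set.finite_singleton S, by simpa using h, by simp⟩

lemma isSemialgebraic_empty : IsSemialgebraic (∅ : Set (Fin n → ℝ)) :=
  ⟨∅, Set.finite_empty, by simp, by simp⟩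

lemma IsSemialgebraic.union {S T : Set (Fin n → ℝ)} (hS : IsSemialgebraic S)
    (hT : IsSemialgebraic T) : IsSemialgebraic (S ∪ T) := by
  obtain ⟨C, hC, hC', rfl⟩ := hS
  obtain ⟨D, hD, hD', rfl⟩ := hT
  exact ⟨C ∪ D, hC.union hD, fun T hT => hT.elim (hC' T) (hD' T), (Set.sUnion_union C D).symm⟩

lemma IsBasicSemialgebraic.inter {S T : Set (Fin n → ℝ)} (hS : IsBasicSemialgebraic S)
    (hT : IsBasicSemialgebraic T) : IsBasicSemialgebraic (S ∩ T) := by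
  classical
  obtain ⟨P, J, rfl⟩ := hS
  obtain ⟨Q, K, rfl⟩ := hT
  refine ⟨P * P + Q * Q, J ∪ K, ?_⟩
  ext x
  simp only [Set.mem_inter_iff, Set.mem_ofPred_eq, map_add, map_mul, Finset.mem_union, or_imp,
    forall_and, mul_self_add_mul_self_eq_zero]
  tauto

lemma IsSemialgebraic.inter {S T : Set (Fin n → ℝ)} (hS : IsSemialgebraic S)
    (hT : IsSemialgebraic T) : IsSemialgebraic (S ∩ T) := by
  obtain ⟨C, hC, hC', rfl⟩ := hS
  obtain ⟨D, hD, hD', rfl⟩ := hT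
  refine ⟨Set.image2 (· ∩ ·) C D, hC.image2 _ hD, ?_, ?_⟩
  · rintro _ ⟨S, hS, T, hT, rfl⟩
    exact (hC' S hS).inter (hD' T hT)
  · ext x
    simp only [Set.mem_inter_iff, Set.mem_sUnion, Set.mem_image2, exists_exists_and_exists_and_eq_and]
    constructor
    · rintro ⟨⟨S, hS, hxS⟩, T, hT, hxT⟩
      exact ⟨S, hS, T, hT, hxS, hxT⟩
    · rintro ⟨S, hS, T, hT, hxS, hxT⟩
      exact ⟨⟨S, hS, hxS⟩, T, hT, hxT⟩

lemma isSemialgebraic_pos (p : MvPolynomial (Fin n) ℝ) :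
    IsSemialgebraic {x | 0 < MvPolynomial.eval x p} :=
  IsBasicSemialgebraic.isSemialgebraic ⟨0, {p}, by simp⟩

lemma isSemialgebraic_eq_zero (p : MvPolynomial (Fin n) ℝ) :
    IsSemialgebraic {x | MvPolynomial.eval x p = 0} :=
  IsBasicSemialgebraic.isSemialgebraic ⟨p, ∅, by simp⟩

lemma isSemialgebraic_univ : IsSemialgebraic (Set.univ : Set (Fin n → ℝ)) := by
  simpa using isSemialgebraic_eq_zero (0 : MvPolynomial (Fin n) ℝ)

/-- Negated conditions become admissible again: `P ≠ 0` is `P² > 0`, and `Q ≤ 0` is `Q = 0` or `-Q >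
0`. -/
lemma IsBasicSemialgebraic.compl {S : Set (Fin n → ℝ)} (hS : IsBasicSemialgebraic S) :
    IsSemialgebraic Sᶜ := by
  classical
  obtain ⟨P, J, rfl⟩ := hS
  have hJ : IsSemialgebraic {x | ∃ Q ∈ J, MvPolynomial.eval x Q ≤ 0} := by
    induction J using Finset.induction_on with
    | empty => simpa using isSemialgebraic_empty
    | insert Q J _ ih =>
      have h := ((isSemialgebraic_eq_zero Q).union (isSemialgebraic_pos (-Q))).union ih
      convert h using 1
      ext x
      simp only [Finset.mem_insert, exists_eq_or_imp, Set.mem_union, Set.mem_ofPred_eq, map_neg,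
        Left.neg_pos_iff, le_iff_eq_or_lt]
  convert (isSemialgebraic_pos (P * P)).union hJ using 1
  ext x
  simp only [Set.mem_compl_iff, Set.mem_union, Set.mem_ofPred_eq, map_mul, mul_self_pos, not_and_or]
  simp

lemma IsSemialgebraic.compl {S : Set (Fin n → ℝ)} (hS : IsSemialgebraic S) :
    IsSemialgebraic Sᶜ := by
  obtain ⟨C, hC, hC', rfl⟩ := hS
  induction C, hC using Set.Finite.induction_on with
  | empty => simpa using isSemialgebraic_univ
  | insert _ _ ih =>
    rw [Set.sUnion_insert, Set.compl_union]
    exact (hC' _ (Set.mem_insert _ _)).compl.inter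
      (ih fun T hT => hC' T (Set.mem_insert_of_mem _ hT))

lemma IsBasicSemialgebraic.mem_semialg {S : Set (Fin n → ℝ)} (hS : IsBasicSemialgebraic S) :
    S ∈ semialg (Fin n) := by
  obtain ⟨P, J, rfl⟩ := hS
  have h := setOf_eval_eq_mem P 0
  simp only [map_zero] at h
  exact setOf_and_mem h (setOf_forall_finset_mem J fun Q _ => setOf_eval_pos_mem Q)

lemma mem_semialg_iff {S : Set (Fin n → ℝ)} : S ∈ semialg (Fin n) ↔ IsSemialgebraic S := by
  constructor
  · intro hS
    induction hS using semialg_induction with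
    | pos p => exact isSemialgebraic_pos p
    | bot => exact isSemialgebraic_empty
    | sup S _ T _ hS hT => exact hS.union hT
    | compl S _ hS => exact hS.compl
  · rintro ⟨C, hC, hC', rfl⟩
    induction C, hC using Set.Finite.induction_on with
    | empty => simpa using (semialg (Fin n)).bot_mem
    | insert _ _ ih =>
      rw [Set.sUnion_insert]
      exact BooleanSubalgebra.sup_mem (hC' _ (Set.mem_insert _ _)).mem_semialg
        (ih fun T hT => hC' T (Set.mem_insert_of_mem _ hT))

end Sets

/-! ### Value functions are semi-algebraic -/

section Functions

variable {σ : Type*}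

lemma setOf_exists_real_mem {Q : (σ → ℝ) → ℝ → Prop}
    (h : {z : Option σ → ℝ | Q (fun i => z (some i)) (z none)} ∈ semialg (Option σ)) :
    {x | ∃ t, Q x t} ∈ semialg σ := setOf_exists_option_mem h

lemma setOf_forall_real_mem {Q : (σ → ℝ) → ℝ → Prop}
    (h : {z : Option σ → ℝ | Q (fun i => z (some i)) (z none)} ∈ semialg (Option σ)) :
    {x | ∀ t, Q x t} ∈ semialg σ := by
  have := setOf_not_mem (setOf_exists_real_mem (Q := fun x t => ¬ Q x t) (setOf_not_mem h))
  simpa using this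

lemma setOf_coord_lt_mem (i j : σ) : {x : σ → ℝ | x i < x j} ∈ semialg σ := by
  simpa using setOf_eval_lt_mem (MvPolynomial.X i) (MvPolynomial.X j)

lemma EReal.lt_coe_iff_exists {h : EReal} {s : ℝ} :
    h < s ↔ ∃ t : ℝ, t < s ∧ ¬ ((t : EReal) < h) := by
  constructor
  · intro hs
    obtain ⟨t, h1, h2⟩ := EReal.lt_iff_exists_real_btwn.1 hs
    exact ⟨t, by exact_mod_cast h2, h1.not_gt⟩
  · rintro ⟨t, h1, h2⟩
    exact (not_lt.1 h2).trans_lt (by exact_mod_cast h1)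

/-- The relation `h x < t` encodes everything: `⊤` means no real `t` works, `⊥` means all do, and `h
x = z` means that `z` fails while every `t > z` works. -/
lemma mem_SA_of_lt {n : ℕ} {h : (Fin n → ℝ) → EReal}
    (hlt : {z : Option (Fin n) → ℝ | h (fun i => z (some i)) < (z none : EReal)} ∈
      semialg (Option (Fin n))) : h ∈ SA n := by
  have htop : {x | h x = ⊤} ∈ semialg (Fin n) := by
    have := setOf_not_mem (setOf_exists_real_mem (Q := fun x t => h x < (t : EReal)) hlt)
    convert this using 3 with x
    constructor
    · rintro hx ⟨t, ht⟩
      rw [hx] at ht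
      exact not_top_lt ht
    · intro hx
      by_contra hne
      obtain ⟨t, ht, _⟩ := EReal.lt_iff_exists_real_btwn.1 (lt_top_iff_ne_top.2 hne)
      exact hx ⟨t, ht⟩
  have hbot : {x | h x = ⊥} ∈ semialg (Fin n) := by
    have := setOf_forall_real_mem (Q := fun x t => h x < (t : EReal)) hlt
    convert this using 3 with x
    exact EReal.eq_bot_iff_forall_lt _
  have hfin : {x | h x ≠ ⊤ ∧ h x ≠ ⊥} ∈ semialg (Fin n) :=
    setOf_and_mem (setOf_not_mem htop) (setOf_not_mem hbot)
  refine ⟨mem_semialg_iff.1 hfin, mem_semialg_iff.1 htop, mem_semialg_iff.1 hbot, ?_⟩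
  rw [IsSemialgebraicFunOn, ← mem_semialg_iff]
  have hz : {z : Fin (n + 1) → ℝ | h (fun i => z i.castSucc) < (z (Fin.last n) : EReal)} ∈
      semialg (Fin (n + 1)) :=
    reindex_mem_semialg (fun i : Option (Fin n) => i.elim (Fin.last n) Fin.castSucc) hlt
  have hall : {z : Fin (n + 1) → ℝ | ∀ t, z (Fin.last n) < t →
      h (fun i => z i.castSucc) < (t : EReal)} ∈ semialg (Fin (n + 1)) := by
    refine setOf_forall_real_mem (setOf_imp_mem (setOf_coord_lt_mem _ _) ?_)
    exact reindex_mem_semialg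
      (fun i : Option (Fin n) => i.elim none fun j => some j.castSucc) hlt
  convert setOf_and_mem (setOf_not_mem hz) hall using 3 with z
  constructor
  · rintro ⟨x, hx, rfl⟩
    simp only [Fin.snoc_castSucc, Fin.snoc_last, EReal.coe_toReal hx.1 hx.2, lt_irrefl,
      not_false_eq_true, true_and]
    intro t ht
    rw [← EReal.coe_toReal hx.1 hx.2]
    exact_mod_cast ht
  · rintro ⟨h1, h2⟩
    have heq : h (fun i => z i.castSucc) = (z (Fin.last n) : EReal) := by
      refine le_antisymm ?_ (not_lt.1 h1)
      by_contra! hlt'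
      obtain ⟨t, ht1, ht2⟩ := EReal.lt_iff_exists_real_btwn.1 hlt'
      exact (h2 t (by exact_mod_cast ht1)).not_gt ht2
    refine ⟨fun i => z i.castSucc, ?_, ?_⟩
    · simp [heq]
    · simp only [heq, EReal.toReal_coe]
      funext i
      refine Fin.lastCases ?_ (fun i => ?_) i <;> simp

lemma mem_SA_of_gt {n : ℕ} {h : (Fin n → ℝ) → EReal}
    (hgt : {z : Option (Fin n) → ℝ | (z none : EReal) < h (fun i => z (some i))} ∈
      semialg (Option (Fin n))) : h ∈ SA n := by
  refine mem_SA_of_lt ?_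
  simp only [EReal.lt_coe_iff_exists]
  refine setOf_exists_real_mem (setOf_and_mem (setOf_coord_lt_mem _ _) (setOf_not_mem ?_))
  exact reindex_mem_semialg (fun i : Option (Fin n) => i.elim none fun j => some (some j)) hgt

lemma setOf_coe_le_coord_mem (a : EReal) (i : σ) :
    {x : σ → ℝ | a ≤ (x i : EReal)} ∈ semialg σ := by
  induction a with
  | bot => simpa using (semialg σ).top_mem
  | top => simpa using (semialg σ).bot_mem
  | coe a => simpa using setOf_eval_le_mem (MvPolynomial.C a) (MvPolynomial.X i)

lemma setOf_coord_le_coe_mem (a : EReal) (i : σ) :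
    {x : σ → ℝ | (x i : EReal) ≤ a} ∈ semialg σ := by
  induction a with
  | bot => simpa using (semialg σ).bot_mem
  | top => simpa using (semialg σ).top_mem
  | coe a => simpa using setOf_eval_le_mem (MvPolynomial.X i) (MvPolynomial.C a)

lemma box_mem_semialg {m : ℕ} (a b : Fin m → EReal) : box a b ∈ semialg (Fin m) := by
  have := setOf_forall_finset_mem Finset.univ fun (i : Fin m) _ =>
    setOf_and_mem (setOf_coe_le_coord_mem (a i) i) (setOf_coord_le_coe_mem (b i) i)
  simpa [box] using this

lemma lowerArgmin_mem_semialg {n m : ℕ} (Q : MvPolynomial (Fin n ⊕ Fin m) ℝ)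
    {Y : Set (Fin m → ℝ)} (hY : Y ∈ semialg (Fin m)) :
    {z : Fin n ⊕ Fin m → ℝ | z ∘ Sum.inr ∈ lowerArgmin Q Y (z ∘ Sum.inl)} ∈
      semialg (Fin n ⊕ Fin m) := by
  refine setOf_and_mem (reindex_mem_semialg Sum.inr hY) ?_
  have h : {w : (Fin n ⊕ Fin m) ⊕ Fin m → ℝ | w ∘ Sum.inr ∈ Y →
      MvPolynomial.eval w (MvPolynomial.rename Sum.inl Q) ≤
      MvPolynomial.eval w (MvPolynomial.rename (Sum.map Sum.inl id) Q)} ∈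
      semialg ((Fin n ⊕ Fin m) ⊕ Fin m) :=
    setOf_imp_mem (reindex_mem_semialg Sum.inr hY) (setOf_eval_le_mem _ _)
  convert setOf_forall_sum_mem h using 3 with z
  refine forall_congr' fun y => ?_
  simp only [evalPair, Set.mem_ofPred_eq, MvPolynomial.eval_rename, Sum.elim_comp_inr,
    Sum.elim_comp_inl, Sum.elim_comp_map, Function.comp_id, Sum.elim_comp_inl_inr]

/-- A strict bound on an infimum or supremum is witnessed by a single minimizer `y`, so neither
attainment nor nonemptiness of the argmin matters. -/
theorem valueFunction_mem_SA {n m : ℕ} (mode : Mode) (P Q : MvPolynomial (Fin n ⊕ Fin m) ℝ)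
    {Y : Set (Fin m → ℝ)} (hY : Y ∈ semialg (Fin m)) : valueFunction mode P Q Y ∈ SA n := by
  have hΘ := reindex_mem_semialg
    (Sum.map some id : Fin n ⊕ Fin m → Option (Fin n) ⊕ Fin m) (lowerArgmin_mem_semialg Q hY)
  let P' : MvPolynomial (Option (Fin n) ⊕ Fin m) ℝ := MvPolynomial.rename (Sum.map some id) P
  let s : MvPolynomial (Option (Fin n) ⊕ Fin m) ℝ := MvPolynomial.X (Sum.inl none)
  have hP' : ∀ (z : Option (Fin n) → ℝ) (y : Fin m → ℝ), MvPolynomial.eval (Sum.elim z y) P' =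
      evalPair P (fun i => z (some i)) y := by
    intro z y
    simp only [P', evalPair, MvPolynomial.eval_rename, Sum.elim_comp_map, Function.comp_id]
    rfl
  cases mode with
  | optim =>
    refine mem_SA_of_lt ?_
    convert setOf_exists_sum_mem (setOf_and_mem hΘ (setOf_eval_lt_mem P' s)) using 3 with z
    simp only [valueFunction, iInf_lt_iff, EReal.coe_lt_coe_iff, exists_prop]
    refine exists_congr fun y => ?_
    rw [Set.mem_ofPred_eq, hP', MvPolynomial.eval_X]
    rfl
  | pessim =>
    refine mem_SA_of_gt ?_
    convert setOf_exists_sum_mem (setOf_and_mem hΘ (setOf_eval_lt_mem s P')) using 3 with z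
    simp only [valueFunction, lt_iSup_iff, EReal.coe_lt_coe_iff, exists_prop]
    refine exists_congr fun y => ?_
    rw [Set.mem_ofPred_eq, hP', MvPolynomial.eval_X]
    rfl

theorem convexOverBoxUnbound_subset_SA (mode : Mode) (n : ℕ) :
    ConvexOverBoxUnbound mode n ⊆ SA n := by
  rintro _ ⟨m, P, Q, a, b, _, _, rfl⟩
  exact valueFunction_mem_SA mode P Q (box_mem_semialg a b)

lemma convex_box {m : ℕ} (a b : Fin m → EReal) : Convex ℝ (box a b) := by
  have : box a b = Set.univ.pi fun i => {t : ℝ | a i ≤ (t : EReal) ∧ (t : EReal) ≤ b i} := by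
    ext y
    simp [box]
  rw [this]
  refine convex_pi fun i _ => Set.OrdConnected.convex ⟨fun s hs t ht u hu => ⟨?_, ?_⟩⟩
  · exact hs.1.trans (by exact_mod_cast hu.1)
  · exact le_trans (by exact_mod_cast hu.2) ht.2

theorem convexUnbound_subset (mode : Mode) (n : ℕ) :
    ConvexUnbound mode n ⊆ ConvexOverBoxUnbound mode n := by
  rintro _ ⟨m, P, Q, a, b, hab, hQ, rfl⟩
  exact ⟨m, P, Q, a, b, hab, fun x => (hQ x).subset (Set.subset_univ _) (convex_box a b), rfl⟩

end Functions

end Bilevel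

namespace Bilevel

/-! ### Piecewise polynomials as polynomials in coordinates and indicators -/

section PiecewisePolynomial

variable {n : ℕ}

/-- The coordinate functions and the indicators of the sets where a polynomial is positive. -/
noncomputable def coordOrIndicator :
    Fin n ⊕ MvPolynomial (Fin n) ℝ → (Fin n → ℝ) → ℝ :=
  Sum.elim (fun i x => x i)
    fun p => {x | 0 < MvPolynomial.eval x p}.indicator fun _ => (1 : ℝ)

/-- Boolean operations are polynomial in indicators: a union gives `s + t - s t`, a complement `1 -
s`. -/
lemma indicator_mem_range_aeval {S : Set (Fin n → ℝ)} (hS : S ∈ semialg (Fin n)) :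
    S.indicator (fun _ => (1 : ℝ)) ∈
      (MvPolynomial.aeval (R := ℝ) (coordOrIndicator (n := n))).range := by
  classical
  induction hS using semialg_induction with
  | pos p => exact ⟨MvPolynomial.X (Sum.inr p), by simp [coordOrIndicator]⟩
  | bot =>
    rw [Set.indicator_empty]
    exact zero_mem _
  | sup S _ T _ hS hT =>
    convert sub_mem (add_mem hS hT) (mul_mem hS hT) using 1
    funext x
    by_cases h1 : x ∈ S <;> by_cases h2 : x ∈ T <;> simp [Set.indicator, h1, h2]
  | compl S _ hS =>
    convert sub_mem (one_mem _) hS using 1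
    funext x
    by_cases h1 : x ∈ S <;> simp [Set.indicator, h1]

lemma eval_mem_range_aeval (p : MvPolynomial (Fin n) ℝ) :
    (fun x => MvPolynomial.eval x p) ∈
      (MvPolynomial.aeval (R := ℝ) (coordOrIndicator (n := n))).range := by
  induction p using MvPolynomial.induction_on with
  | C c =>
    simp only [MvPolynomial.eval_C]
    exact const_mem c
  | add p q hp hq =>
    simp only [map_add]
    exact add_mem hp hq
  | mul_X p i hp =>
    have hi : (fun x : Fin n → ℝ => x i) ∈
        (MvPolynomial.aeval (R := ℝ) (coordOrIndicator (n := n))).range :=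
      ⟨MvPolynomial.X (Sum.inl i), by simp [coordOrIndicator]⟩
    simp only [map_mul, MvPolynomial.eval_X]
    exact mul_mem hp hi

lemma IsPiecewisePolynomial.mem_range_aeval {f : (Fin n → ℝ) → ℝ} (hf : IsPiecewisePolynomial f) :
    f ∈ (MvPolynomial.aeval (R := ℝ) (coordOrIndicator (n := n))).range := by
  obtain ⟨N, S, p, hS, _, _, hf⟩ := hf
  have : f = ∑ i, (S i).indicator (fun _ => (1 : ℝ)) * fun x => MvPolynomial.eval x (p i) := by
    funext x
    simp [hf x]
  rw [this]
  exact sum_mem fun i _ =>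
    mul_mem (indicator_mem_range_aeval (mem_semialg_iff.2 (hS i))) (eval_mem_range_aeval (p i))

/-- A piecewise polynomial function is a polynomial in finitely many (at least one) coordinates
and indicators of sets where a polynomial is positive. -/
lemma IsPiecewisePolynomial.exists_eq_eval {f : (Fin n → ℝ) → ℝ} (hf : IsPiecewisePolynomial f) :
    ∃ (k : ℕ) (v : Fin (k + 1) → Fin n ⊕ MvPolynomial (Fin n) ℝ)
      (F : MvPolynomial (Fin (k + 1)) ℝ),
      ∀ x, f x = MvPolynomial.eval (fun j => coordOrIndicator (v j) x) F := by
  obtain ⟨G, hG⟩ := hf.mem_range_aeval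
  obtain ⟨k, v, _, F, rfl⟩ := MvPolynomial.exists_fin_rename G
  -- The extra generator does not occur in the polynomial; it ensures at least one lower-level
  -- variable, as an unbounded box needs one.
  refine ⟨k, Fin.snoc v (Sum.inr 0), MvPolynomial.rename Fin.castSucc F, fun x => ?_⟩
  have h : (Pi.evalAlgHom ℝ (fun _ : Fin n → ℝ => ℝ) x).comp
      (MvPolynomial.aeval (R := ℝ) fun j => coordOrIndicator (v j)) =
      MvPolynomial.aeval fun j => coordOrIndicator (v j) x := by
    ext i
    simp
  have := DFunLike.congr_fun h F
  rw [← hG, MvPolynomial.eval_rename]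
  simpa [MvPolynomial.aeval_rename, Function.comp_def, MvPolynomial.coe_aeval_eq_eval] using this

end PiecewisePolynomial

/-! ### The least-squares lower level -/

section LowerLevel

variable {n m : ℕ}

/-- The lower-level objective `∑ⱼ (cⱼ(x) yⱼ - 1)²`. -/
noncomputable def squaresObjective (c : Fin m → MvPolynomial (Fin n) ℝ) :
    MvPolynomial (Fin n ⊕ Fin m) ℝ :=
  ∑ j, (MvPolynomial.rename Sum.inl (c j) * MvPolynomial.X (Sum.inr j) - 1) ^ 2

lemma evalPair_rename_inl (p : MvPolynomial (Fin n) ℝ) (x : Fin n → ℝ) (y : Fin m → ℝ) :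
    MvPolynomial.eval (Sum.elim x y) (MvPolynomial.rename Sum.inl p) = MvPolynomial.eval x p := by
  rw [MvPolynomial.eval_rename, Sum.elim_comp_inl]

lemma evalPair_squaresObjective (c : Fin m → MvPolynomial (Fin n) ℝ) (x : Fin n → ℝ)
    (y : Fin m → ℝ) :
    evalPair (squaresObjective c) x y = ∑ j, (MvPolynomial.eval x (c j) * y j - 1) ^ 2 := by
  simp [evalPair, squaresObjective, evalPair_rename_inl]

lemma convexOn_squaresObjective (c : Fin m → MvPolynomial (Fin n) ℝ) (x : Fin n → ℝ) :
    ConvexOn ℝ Set.univ (evalPair (squaresObjective c) x) := by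
  refine ⟨convex_univ, fun u _ v _ a b ha hb hab => ?_⟩
  simp only [evalPair_squaresObjective, smul_eq_mul, Finset.mul_sum, ← Finset.sum_add_distrib]
  refine Finset.sum_le_sum fun j _ => ?_
  simp only [Pi.add_apply, Pi.smul_apply, smul_eq_mul]
  obtain rfl : b = 1 - a := by linarith
  generalize MvPolynomial.eval x (c j) = d
  -- This is exactly the convexity gap of the square.
  have : 0 ≤ a * (1 - a) * (d * u j - d * v j) ^ 2 := by positivity
  linarith

lemma mem_box_zero_top {y : Fin m → ℝ} : y ∈ box (fun _ => 0) (fun _ => ⊤) ↔ ∀ j, 0 ≤ y j := by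
  simp [box]

lemma sq_mul_sub_one_ge {c t : ℝ} (ht : 0 ≤ t) :
    (c * (if 0 < c then c⁻¹ else 0) - 1) ^ 2 ≤ (c * t - 1) ^ 2 := by
  split_ifs with hc
  · rw [mul_inv_cancel₀ hc.ne', sub_self, zero_pow two_ne_zero]
    positivity
  · have : c * t ≤ 0 := mul_nonpos_of_nonpos_of_nonneg (not_lt.1 hc) ht
    nlinarith

/-- For `c ≤ 0` the product `c t` is nonpositive, so `(c t - 1)² = 1` forces `c t = 0`. When `c =
0`, `t` stays free, and only the product is determined. -/
lemma mul_eq_indicator_of_sq_eq {c t : ℝ} (ht : 0 ≤ t)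
    (h : (c * (if 0 < c then c⁻¹ else 0) - 1) ^ 2 = (c * t - 1) ^ 2) :
    c * t = if 0 < c then 1 else 0 := by
  split_ifs at h ⊢ with hc
  · rw [mul_inv_cancel₀ hc.ne', sub_self, zero_pow two_ne_zero] at h
    have := pow_eq_zero_iff two_ne_zero |>.1 h.symm
    linarith
  · have : c * t ≤ 0 := mul_nonpos_of_nonpos_of_nonneg (not_lt.1 hc) ht
    nlinarith

lemma lowerArgmin_squaresObjective_nonempty (c : Fin m → MvPolynomial (Fin n) ℝ) (x : Fin n → ℝ) :
    (lowerArgmin (squaresObjective c) (box (fun _ => 0) (fun _ => ⊤)) x).Nonempty := by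
  refine ⟨fun j => if 0 < MvPolynomial.eval x (c j) then (MvPolynomial.eval x (c j))⁻¹ else 0,
    mem_box_zero_top.2 fun j => ?_, fun y hy => ?_⟩
  · split_ifs with h
    · exact (inv_pos.2 h).le
    · exact le_rfl
  · simp only [evalPair_squaresObjective]
    exact Finset.sum_le_sum fun j _ => sq_mul_sub_one_ge (mem_box_zero_top.1 hy j)

/-- The objective is separable: equality with the explicit minimum, together with termwise
inequalities, gives equality in every term. -/
lemma mul_eq_indicator_of_mem_lowerArgmin {c : Fin m → MvPolynomial (Fin n) ℝ} {x : Fin n → ℝ}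
    {y : Fin m → ℝ} (hy : y ∈ lowerArgmin (squaresObjective c) (box (fun _ => 0) (fun _ => ⊤)) x)
    (j : Fin m) : MvPolynomial.eval x (c j) * y j =
      if 0 < MvPolynomial.eval x (c j) then 1 else 0 := by
  obtain ⟨hy, hmin⟩ := hy
  rw [mem_box_zero_top] at hy
  have h := hmin
    (fun j => if 0 < MvPolynomial.eval x (c j) then (MvPolynomial.eval x (c j))⁻¹ else 0)
    (mem_box_zero_top.2 fun j => by
      split_ifs with h
      · exact (inv_pos.2 h).le
      · exact le_rfl)
  simp only [evalPair_squaresObjective] at h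
  have hle := fun j (_ : j ∈ Finset.univ) =>
    sq_mul_sub_one_ge (c := MvPolynomial.eval x (c j)) (hy j)
  exact mul_eq_indicator_of_sq_eq (hy j)
    ((Finset.sum_eq_sum_iff_of_le hle).1 (le_antisymm (Finset.sum_le_sum hle) h) j
      (Finset.mem_univ j))

lemma valueFunction_eq_of_constant {mode : Mode} {P Q : MvPolynomial (Fin n ⊕ Fin m) ℝ}
    {Y : Set (Fin m → ℝ)} {x : Fin n → ℝ} {v : ℝ} (hne : (lowerArgmin Q Y x).Nonempty)
    (h : ∀ y ∈ lowerArgmin Q Y x, evalPair P x y = v) : valueFunction mode P Q Y x = v := by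
  cases mode with
  | optim =>
    have : valueFunction Mode.optim P Q Y x = ⨅ y ∈ lowerArgmin Q Y x, (v : EReal) :=
      biInf_congr fun y hy => by rw [h y hy]
    rw [this, biInf_const hne]
  | pessim =>
    have : valueFunction Mode.pessim P Q Y x = ⨆ y ∈ lowerArgmin Q Y x, (v : EReal) :=
      biSup_congr fun y hy => by rw [h y hy]
    rw [this, biSup_const hne]

theorem PP_subset_convexUnbound (mode : Mode) (n : ℕ) : PP n ⊆ ConvexUnbound mode n := by
  rintro h ⟨f, hf, hh⟩
  obtain ⟨k, v, F, hF⟩ := hf.exists_eq_eval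
  -- At indices of coordinate functions `c j = 0`: the square is constantly `1`, and `w j` does not
  -- involve the free variable `y j`.
  let c : Fin (k + 1) → MvPolynomial (Fin n) ℝ := fun j => (v j).elim (fun _ => 0) id
  let w : Fin (k + 1) → MvPolynomial (Fin n ⊕ Fin (k + 1)) ℝ := fun j =>
    (v j).elim (fun i => MvPolynomial.X (Sum.inl i))
      fun p => MvPolynomial.rename Sum.inl p * MvPolynomial.X (Sum.inr j)
  refine ⟨k + 1, MvPolynomial.bind₁ w F, squaresObjective c, fun _ => 0, fun _ => ⊤,
    ⟨⟨0, mem_box_zero_top.2 fun _ => le_rfl⟩, 0, Or.inr rfl⟩, convexOn_squaresObjective c, ?_⟩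
  funext x
  rw [hh x]
  refine (valueFunction_eq_of_constant (lowerArgmin_squaresObjective_nonempty c x)
    fun y hy => ?_).symm
  have hw : ∀ j, MvPolynomial.eval (Sum.elim x y) (w j) = coordOrIndicator (v j) x := by
    intro j
    have hj := mul_eq_indicator_of_mem_lowerArgmin hy j
    rcases hv : v j with i | p
    · simp [w, hv, coordOrIndicator]
    · simp only [c, hv, Sum.elim_inr, id_eq] at hj
      simp [w, hv, coordOrIndicator, evalPair_rename_inl, hj, Set.indicator]
  rw [hF x, evalPair, MvPolynomial.eval, MvPolynomial.eval₂Hom_bind₁]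
  simp only [← hw]
  rfl

end LowerLevel

end Bilevel

theorem mainTheorem6 (n : ℕ) :
    (Bilevel.PP n ⊆ Bilevel.ConvexUnbound Bilevel.Mode.optim n ∧
      Bilevel.ConvexUnbound Bilevel.Mode.optim n ⊆
        Bilevel.ConvexOverBoxUnbound Bilevel.Mode.optim n ∧
      Bilevel.ConvexOverBoxUnbound Bilevel.Mode.optim n ⊆ Bilevel.SA n) ∧
    (Bilevel.PP n ⊆ Bilevel.ConvexUnbound Bilevel.Mode.pessim n ∧
      Bilevel.ConvexUnbound Bilevel.Mode.pessim n ⊆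
        Bilevel.ConvexOverBoxUnbound Bilevel.Mode.pessim n ∧
      Bilevel.ConvexOverBoxUnbound Bilevel.Mode.pessim n ⊆ Bilevel.SA n) :=
  ⟨⟨Bilevel.PP_subset_convexUnbound _ n, Bilevel.convexUnbound_subset _ n,
    Bilevel.convexOverBoxUnbound_subset_SA _ n⟩,
   ⟨Bilevel.PP_subset_convexUnbound _ n, Bilevel.convexUnbound_subset _ n,
    Bilevel.convexOverBoxUnbound_subset_SA _ n⟩⟩
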